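/- There is a universal constant $C>0$ with the following property. Let $n,p,m$ be the dimensions, let $X\in\mathbb R^{n\times p}$ and $B^*\in\mathbb R^{p\times m}$ be fixed matrices, let $Y$ be a random matrix in $\mathbb R^{n\times m}$, and let $l_0(\eta;Y)$ be a real-valued loss that is differentiable in $\eta\in\mathbb R^{n\times m}$. Write $\langle A,B\rangle=\sum_{i,j}A_{ij}B_{ij}$, let $\|\cdot\|_F$ be the Frobenius norm, and let $\|B\|_{2,\mathcal C}$ be the number of distinct rows of $B$. Put $\mathbf D_2(A,B)=\|A-B\|_F^2/2$ and, for a differentiable $\psi$, $$\mathbf\Delta_\psi(\alpha,\beta)=\psi(\alpha)-\psi(\beta)-\langle\nabla\psi(\beta),\alpha-\beta\rangle,\qquad \bar{\mathbf\Delta}_\psi(\alpha,\beta)=\tfrac12\{\mathbf\Delta_\psi(\alpha,\beta)+\mathbf\Delta_\psi(\beta,\alpha)\}.$$ Assume that the effective noise $E=-\nabla l_0(XB^*;Y)$ has mean zero and is sub-Gaussian with scale bounded by $\sigma\ge 0$, i.e. $\|\langle E,A\rangle\|_{\psi_2}\le\sigma\|A\|_F$ for every $A\in\mathbb R^{n\times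 m}$, where $\|\xi\|_{\psi_2}=\inf\{t>0:\mathbb E\exp[(\xi/t)^2]\le 2\}$. Let $q,r$ be integers with $r\ge\operatorname{rank}(B^*)$ and $\|B^*\|_{2,\mathcal C}\le q\le p$, let $\mathcal S=\{B\in\mathbb R^{p\times m}:\operatorname{rank}(B)\le r,\ \|B\|_{2,\mathcal C}\le q\}$, and define $P_o(q,r)=\{q\wedge\operatorname{rank}(X)+m\}r+(p-q)\log q$ (with $0\log 0=0$). For $\rho>0$ let $$G_\rho(B;B^-)=l_0(XB;Y)-\mathbf\Delta_{l_0(\cdot;Y)}(XB,XB^-)+\rho\,\mathbf D_2(B,B^-),$$ and let $\hat B$ be any (random) fixed point, that is, almost surely $\hat B\in\operatorname{arg\,min}_{B\in\mathcal S}G_\rho(B;\hat B)$. Assume that for some $\delta>0$ and $K\ge 0$, almost surely, $$\rho\,\mathbf D_2(B_1,B_2)\le 2\bar{\mathbf\Delta}_{l_0(\cdot;Y)}(XB_1,XB_2)-\delta\,\mathbf D_2(XB_1,XB_2)+K\sigma^2P_o(q,r)\qquad\text{for all }B_1,B_2\in\mathcal S.$$ Then $\|X\hat B-XB^*\|_F^2$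 is integrable and $$\mathbb E\|X\hat B-XB^*\|_F^2\le C\,\frac{(K\delta)\vee 1}{\delta^2}\,\bigl\{\sigma^2(q\wedge\operatorname{rank}(X)+m)r+\sigma^2(p-q)\log q+\sigma^2\bigr\}.$$ -/

import Mathlib

open MeasureTheory
open scoped ENNReal Matrix.Norms.Frobenius

noncomputable section

/-- Number of distinct rows `‖B‖_{2,𝒞}` of a matrix. -/
def numDistinctRows {p m : ℕ} (B : Matrix (Fin p) (Fin m) ℝ) : ℕ :=
  (Set.range fun i : Fin p => B i).ncard

/-- Inner product `⟨A, B⟩ = ∑ᵢⱼ Aᵢⱼ Bᵢⱼ` of two real matrices. The associated norm is the Frobenius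
norm, which is the meaning of `‖A‖` for a matrix `A` throughout. -/
def frobInner {n m : ℕ} (A B : Matrix (Fin n) (Fin m) ℝ) : ℝ :=
  ∑ i, ∑ j, A i j * B i j

/-- Gradient of a function of a matrix: the matrix of its partial derivatives. -/
def matGrad {n m : ℕ} (ψ : Matrix (Fin n) (Fin m) ℝ → ℝ) (β : Matrix (Fin n) (Fin m) ℝ) :
    Matrix (Fin n) (Fin m) ℝ :=
  Matrix.of fun i j => fderiv ℝ ψ β (Matrix.single i j 1)

/-- Generalized Bregman function
`Δ_ψ(α, β) = ψ(α) - ψ(β) - ⟨∇ψ(β), α - β⟩`. -/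
def genBregman {n m : ℕ} (ψ : Matrix (Fin n) (Fin m) ℝ → ℝ) (α β : Matrix (Fin n) (Fin m) ℝ) : ℝ :=
  ψ α - ψ β - frobInner (matGrad ψ β) (α - β)

/-- Symmetrized generalized Bregman function. -/
def symBregman {n m : ℕ} (ψ : Matrix (Fin n) (Fin m) ℝ → ℝ) (α β : Matrix (Fin n) (Fin m) ℝ) : ℝ :=
  (genBregman ψ α β + genBregman ψ β α) / 2

/-- `D₂(A, B) = ‖A - B‖_F² / 2`. -/
def D₂ {n m : ℕ} (A B : Matrix (Fin n) (Fin m) ℝ) : ℝ :=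
  ‖A - B‖ ^ 2 / 2

/-- The constraint set: rank at most `r` and at most `q` distinct rows. -/
def crlClass (p m q r : ℕ) : Set (Matrix (Fin p) (Fin m) ℝ) :=
  {B | B.rank ≤ r ∧ numDistinctRows B ≤ q}

/-- Linearized surrogate
`G_ρ(B; B⁻) = l(XB) - Δ_l(XB, XB⁻) + ρ D₂(B, B⁻)` of a loss `l` (the data being fixed). -/
def surrogate {n p m : ℕ} (l : Matrix (Fin n) (Fin m) ℝ → ℝ) (X : Matrix (Fin n) (Fin p) ℝ)
    (ρ : ℝ) (B Bm : Matrix (Fin p) (Fin m) ℝ) : ℝ :=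
  l (X * B) - genBregman l (X * B) (X * Bm) + ρ * D₂ B Bm

/-- `Bh` is a fixed point: it minimizes `G_ρ(· ; Bh)` over the constraint set. -/
def IsCRLFixedPoint {n p m : ℕ} (l : Matrix (Fin n) (Fin m) ℝ → ℝ) (X : Matrix (Fin n) (Fin p) ℝ)
    (ρ : ℝ) (q r : ℕ) (Bh : Matrix (Fin p) (Fin m) ℝ) : Prop :=
  Bh ∈ crlClass p m q r ∧ ∀ B ∈ crlClass p m q r, surrogate l X ρ Bh Bh ≤ surrogate l X ρ B Bh

/-- Complexity `P_o(q, r) = (q ∧ rank X + m) r + (p - q) log q`. -/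
def Po {n p : ℕ} (m : ℕ) (X : Matrix (Fin n) (Fin p) ℝ) (q r : ℕ) : ℝ :=
  ((min q X.rank : ℕ) + (m : ℝ)) * r + ((p : ℝ) - q) * Real.log q

/-- Restricted regularity condition: for all `B₁, B₂` in the constraint set,
`ρ D₂(B₁, B₂) ≤ (2 Δ̄_l - δ D₂)(XB₁, XB₂) + K σ² P_o(q, r)`. -/
def RestrictedRegularity {n p m : ℕ} (l : Matrix (Fin n) (Fin m) ℝ → ℝ)
    (X : Matrix (Fin n) (Fin p) ℝ) (ρ δ K σ : ℝ) (q r : ℕ) : Prop :=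
  ∀ B₁ ∈ crlClass p m q r, ∀ B₂ ∈ crlClass p m q r,
    ρ * D₂ B₁ B₂ ≤
      2 * symBregman l (X * B₁) (X * B₂) - δ * D₂ (X * B₁) (X * B₂) + K * σ ^ 2 * Po m X q r

/-- Orlicz norm `‖ξ‖_{ψ₂} = inf {t > 0 : E exp((ξ/t)²) ≤ 2}`, equal to `∞` if no such `t` exists. -/
def psi2Norm {Ω : Type*} [MeasurableSpace Ω] (μ : Measure Ω) (ξ : Ω → ℝ) : ℝ≥0∞ :=
  ⨅ (t : ℝ) (_ : 0 < t) (_ : ∫⁻ ω, ENNReal.ofReal (Real.exp ((ξ ω / t) ^ 2)) ∂μ ≤ 2),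
    ENNReal.ofReal t

/-- The random matrix `E` is (after vectorization) a sub-Gaussian random vector with mean zero and
scale bounded by `σ`. -/
structure IsCenteredSubGaussian {Ω : Type*} [MeasurableSpace Ω] (μ : Measure Ω) {n m : ℕ}
    (E : Ω → Matrix (Fin n) (Fin m) ℝ) (σ : ℝ) : Prop where
  aemeasurable : ∀ i j, AEMeasurable (fun ω => E ω i j) μ
  mean_zero : ∀ i j, ∫ ω, E ω i j ∂μ = 0
  psi2_le : ∀ A : Matrix (Fin n) (Fin m) ℝ,
    psi2Norm μ (fun ω => frobInner (E ω) A) ≤ ENNReal.ofReal (σ * ‖A‖)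

/-- Effective noise `E = -∇l₀(XB*; Y)`. -/
def effectiveNoise {Ω : Type*} {n p m : ℕ}
    (l₀ : Matrix (Fin n) (Fin m) ℝ → Matrix (Fin n) (Fin m) ℝ → ℝ)
    (X : Matrix (Fin n) (Fin p) ℝ) (Bstar : Matrix (Fin p) (Fin m) ℝ)
    (Y : Ω → Matrix (Fin n) (Fin m) ℝ) (ω : Ω) : Matrix (Fin n) (Fin m) ℝ :=
  -matGrad (fun η => l₀ η (Y ω)) (X * Bstar)

end

/-!
Comparing the fixed point `B̂` with `B*` and inserting the regularity condition gives the
deterministic inequality `δ/2 ‖XB̂ - XB*‖² ≤ ⟨E, XB̂ - XB*⟩ + Kσ² P_o`, so it remains to bound the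
noise term by the square root of the complexity times `‖XB̂ - XB*‖`.

The linear functional `⟨E, ·⟩` is controlled on all differences `XB - XB*` by its maximum over a
finite set of test matrices of norm at most one. The rows of `B` define a partition of the `p`
indices into `q` classes, which places the columns of `XB - XB*` in one of `q ^ (3 (p - q))`
subspaces of dimension at most `2 (q ∧ rank X)`. Within such a subspace a matrix of rank at most
`2r` is a product of two factors with `2r` columns and rows, and products of nets of the two
unit balls give the test matrices. The logarithm of their number is of order `P_o`, and the squares
of that many `ψ₂` variables of scale `σ` have a maximum with mean of order `σ² (P_o + 1)`.
-/

open Module Metric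
open scoped NNReal

section BasicInequality

variable {n p m q r : ℕ} {l : Matrix (Fin n) (Fin m) ℝ → ℝ} {X : Matrix (Fin n) (Fin p) ℝ}
  {ρ δ K σ : ℝ} {B Bh : Matrix (Fin p) (Fin m) ℝ}

theorem isLinearMap_frobInner (A : Matrix (Fin n) (Fin m) ℝ) : IsLinearMap ℝ (frobInner A) where
  map_add B C := by simp [frobInner, mul_add, Finset.sum_add_distrib]
  map_smul c B := by simp [frobInner, Finset.mul_sum, mul_left_comm]

theorem frobInner_neg_left (A B : Matrix (Fin n) (Fin m) ℝ) :
    frobInner (-A) B = -frobInner A B := by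
  simp [frobInner]

theorem frobInner_sub_rev (A B C : Matrix (Fin n) (Fin m) ℝ) :
    frobInner A (B - C) = -frobInner A (C - B) := by
  rw [← (isLinearMap_frobInner A).map_neg, neg_sub]

theorem two_mul_symBregman (l : Matrix (Fin n) (Fin m) ℝ → ℝ) (α β : Matrix (Fin n) (Fin m) ℝ) :
    2 * symBregman l α β =
      frobInner (matGrad l α) (α - β) - frobInner (matGrad l β) (α - β) := by
  rw [symBregman, genBregman, genBregman, frobInner_sub_rev _ β α]
  ring

theorem surrogate_eq (l : Matrix (Fin n) (Fin m) ℝ → ℝ) (X : Matrix (Fin n) (Fin p) ℝ) (ρ : ℝ)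
    (B Bm : Matrix (Fin p) (Fin m) ℝ) :
    surrogate l X ρ B Bm =
      l (X * Bm) - frobInner (matGrad l (X * Bm)) (X * Bm - X * B) + ρ * D₂ Bm B := by
  rw [surrogate, genBregman, D₂, D₂, norm_sub_rev, frobInner_sub_rev _ (X * B)]
  ring

theorem IsCRLFixedPoint.frobInner_matGrad_le (h : IsCRLFixedPoint l X ρ q r Bh)
    (hB : B ∈ crlClass p m q r) :
    frobInner (matGrad l (X * Bh)) (X * Bh - X * B) ≤ ρ * D₂ Bh B := by
  have hself : surrogate l X ρ Bh Bh = l (X * Bh) := by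
    simp [surrogate, genBregman, D₂, (isLinearMap_frobInner _).map_zero]
  have hmin := h.2 B hB
  rw [hself, surrogate_eq] at hmin
  linarith

theorem IsCRLFixedPoint.basic_inequality (h : IsCRLFixedPoint l X ρ q r Bh)
    (hreg : RestrictedRegularity l X ρ δ K σ q r) (hB : B ∈ crlClass p m q r) :
    δ / 2 * ‖X * Bh - X * B‖ ^ 2 ≤
      frobInner (-matGrad l (X * B)) (X * Bh - X * B) + K * σ ^ 2 * Po m X q r := by
  have hfix := h.frobInner_matGrad_le hB
  have hcurv := hreg Bh h.1 B hB
  have hD₂ : D₂ (X * Bh) (X * B) = ‖X * Bh - X * B‖ ^ 2 / 2 := rfl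
  rw [two_mul_symBregman, hD₂] at hcurv
  rw [frobInner_neg_left]
  linarith

end BasicInequality

/-- A finite subset `s` of the unit ball is `c`-norming for `T` if `sup_{u ∈ s} φ u` controls
`φ z / ‖z‖` up to the factor `c`, for every linear functional `φ` and every `z ∈ T`. Norming sets
replace the supremum of a random functional over `T` by a maximum over finitely many variables. -/
structure IsNorming {F : Type*} [NormedAddCommGroup F] [NormedSpace ℝ F] (s : Finset F) (c : ℝ≥0)
    (T : Set F) : Prop where
  norm_le_one : ∀ u ∈ s, ‖u‖ ≤ 1
  apply_le : ∀ (φ : F →ₗ[ℝ] ℝ) (M : ℝ), 0 ≤ M → (∀ u ∈ s, φ u ≤ M) → ∀ z ∈ T, φ z ≤ c * M * ‖z‖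

namespace IsNorming

variable {F G H : Type*} [NormedAddCommGroup F] [NormedSpace ℝ F] [NormedAddCommGroup G]
  [NormedSpace ℝ G] [NormedAddCommGroup H] [NormedSpace ℝ H] {s : Finset F} {t : Finset G}
  {c d : ℝ≥0} {S T : Set F}

theorem mono (hs : IsNorming s c T) (hST : S ⊆ T) : IsNorming s c S :=
  ⟨hs.norm_le_one, fun φ M hM h z hz => hs.apply_le φ M hM h z (hST hz)⟩

theorem biUnion {ι : Type*} [DecidableEq F] {I : Finset ι} {s : ι → Finset F} {T : ι → Set F}
    (hs : ∀ i ∈ I, IsNorming (s i) c (T i)) : IsNorming (I.biUnion s) c (⋃ i ∈ I, T i) where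
  norm_le_one u hu := by
    obtain ⟨i, hi, hui⟩ := Finset.mem_biUnion.1 hu
    exact (hs i hi).norm_le_one u hui
  apply_le φ M hM h z hz := by
    obtain ⟨i, hi, hzi⟩ := Set.mem_iUnion₂.1 hz
    exact (hs i hi).apply_le φ M hM (fun u hu => h u (Finset.mem_biUnion.2 ⟨i, hi, hu⟩)) z hzi

theorem image [DecidableEq G] (hs : IsNorming s c T) (L : F →ₗᵢ[ℝ] G) :
    IsNorming (s.image L) c (L '' T) where
  norm_le_one := by
    simpa only [Finset.forall_mem_image, L.norm_map] using hs.norm_le_one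
  apply_le φ M hM h := by
    rw [Set.forall_mem_image]
    intro z hz
    rw [L.norm_map]
    exact hs.apply_le (φ ∘ₗ L.toLinearMap) M hM (Finset.forall_mem_image.1 h) z hz

theorem image₂ [DecidableEq H] (hs : IsNorming s c Set.univ) (ht : IsNorming t d Set.univ)
    (b : F →ₗ[ℝ] G →ₗ[ℝ] H) (hb : ∀ x y, ‖b x y‖ ≤ ‖x‖ * ‖y‖) :
    IsNorming (Finset.image₂ (fun x y => b x y) s t) (c * d)
      {z | ∃ x y, b x y = z ∧ ‖x‖ * ‖y‖ ≤ ‖z‖} where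
  norm_le_one := by
    rw [Finset.forall_mem_image₂]
    exact fun x hx y hy => (hb x y).trans
      (mul_le_one₀ (hs.norm_le_one x hx) (norm_nonneg y) (ht.norm_le_one y hy))
  apply_le φ M hM h := by
    rintro z ⟨x, y, rfl, hxy⟩
    have hy : ∀ x' ∈ s, φ (b x' y) ≤ d * M * ‖y‖ := fun x' hx' =>
      ht.apply_le (φ ∘ₗ b x') M hM
        (fun y' hy' => Finset.forall_mem_image₂.1 h x' hx' y' hy') y trivial
    calc φ (b x y) ≤ c * (d * M * ‖y‖) * ‖x‖ :=
          hs.apply_le (φ ∘ₗ b.flip y) _ (by positivity) hy x trivial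
      _ = c * d * M * (‖x‖ * ‖y‖) := by ring
      _ ≤ c * d * M * ‖b x y‖ := by gcongr
      _ = ↑(c * d) * M * ‖b x y‖ := by rw [NNReal.coe_mul]

end IsNorming

section UnitBall

variable {F : Type*} [NormedAddCommGroup F] [NormedSpace ℝ F]

theorem one_sub_mul_opNorm_le_of_isCover {N : Set F} {ε : ℝ≥0} {M : ℝ}
    (hN : IsCover ε (closedBall 0 1) N) (φ : F →L[ℝ] ℝ) (h : ∀ y ∈ N, φ y ≤ M) :
    (1 - ε) * ‖φ‖ ≤ M := by
  have hball : ∀ x : F, ‖x‖ ≤ 1 → φ x ≤ M + ‖φ‖ * ε := by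
    intro x hx
    obtain ⟨y, hy, hxy⟩ := hN (mem_closedBall_zero_iff.2 hx)
    have hdist : ‖x - y‖ ≤ ε := by
      rw [← dist_eq_norm, dist_nndist]
      exact_mod_cast hxy
    calc φ x = φ y + φ (x - y) := by rw [map_sub]; ring
      _ ≤ M + ‖φ‖ * ‖x - y‖ := add_le_add (h y hy) ((le_abs_self _).trans (φ.le_opNorm _))
      _ ≤ M + ‖φ‖ * ε := by gcongr
  have hnorm : ‖φ‖ ≤ M + ‖φ‖ * ε := by
    refine φ.opNorm_le_of_unit_norm (by simpa using hball 0 (by simp)) fun x hx => ?_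
    have hneg := hball (-x) (by rw [norm_neg, hx])
    rw [map_neg] at hneg
    exact abs_le'.2 ⟨hball x hx.le, hneg⟩
  linarith

theorem packingNumber_half_unitBall_le [FiniteDimensional ℝ F] :
    packingNumber (1 / 2) (closedBall (0 : F) 1) ≤ 5 ^ finrank ℝ F := by
  classical
  refine iSup₂_le fun C hC => iSup_le fun hsep => ?_
  by_contra! hlt
  obtain ⟨t, htC, ht⟩ := Set.exists_subset_encard_eq (Order.add_one_le_of_lt hlt)
  have hfin : t.Finite := Set.finite_of_encard_eq_coe (k := 5 ^ finrank ℝ F + 1) (by simpa using ht)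
  lift t to Finset F using hfin
  have hball : ∀ x ∈ t.image ((2 : ℝ) • ·), ‖x‖ ≤ 2 := by
    simp only [Finset.forall_mem_image, norm_smul, Real.norm_ofNat]
    intro x hx
    linarith [mem_closedBall_zero_iff.1 (hC (htC hx))]
  have hsep' : ∀ x ∈ t.image ((2 : ℝ) • ·), ∀ y ∈ t.image ((2 : ℝ) • ·), x ≠ y → 1 ≤ ‖x - y‖ := by
    simp only [Finset.forall_mem_image, ← smul_sub, norm_smul, Real.norm_ofNat]
    intro x hx y hy hxy
    have h : 1 / 2 < nndist x y := by
      simpa only [edist_nndist, ENNReal.coe_lt_coe] using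
        hsep (htC hx) (htC hy) (by rintro rfl; exact hxy rfl)
    have h' : (1 / 2 : ℝ) < ‖x - y‖ := by
      rw [← dist_eq_norm, ← coe_nndist]
      exact_mod_cast h
    linarith
  have hcard := Besicovitch.card_le_of_separated _ hball hsep'
  rw [Finset.card_image_of_injective _ (smul_right_injective F two_ne_zero)] at hcard
  rw [Set.encard_coe_eq_coe_finsetCard] at ht
  norm_cast at ht
  omega

theorem exists_isNorming_univ (F : Type*) [NormedAddCommGroup F] [NormedSpace ℝ F]
    [FiniteDimensional ℝ F] :
    ∃ s : Finset F, s.card ≤ 5 ^ finrank ℝ F ∧ IsNorming s 2 Set.univ := by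
  have hle : coveringNumber (1 / 2) (closedBall (0 : F) 1) ≤ 5 ^ finrank ℝ F :=
    (coveringNumber_le_packingNumber _ _).trans packingNumber_half_unitBall_le
  obtain ⟨s, hs, hfin, hcover, hcard⟩ := exists_set_encard_eq_coveringNumber
    (hle.trans_lt (by exact_mod_cast ENat.natCast_lt_top (5 ^ finrank ℝ F))).ne
  lift s to Finset F using hfin
  refine ⟨s, ?_, fun u hu => mem_closedBall_zero_iff.1 (hs hu), fun φ M _ h z _ => ?_⟩
  · rw [← hcard, Set.encard_coe_eq_coe_finsetCard] at hle
    exact_mod_cast hle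
  · have hnorm := one_sub_mul_opNorm_le_of_isCover hcover φ.toContinuousLinearMap h
    norm_num at hnorm
    calc φ z ≤ ‖φ.toContinuousLinearMap‖ * ‖z‖ :=
          (le_abs_self _).trans (φ.toContinuousLinearMap.le_opNorm z)
      _ ≤ 2 * M * ‖z‖ := by gcongr; linarith

end UnitBall

section Selections

variable {ι : Type*} [Fintype ι] [DecidableEq ι] {q : ℕ}

variable (ι q) in
/-- The maps `ι → ι` that retract `ι` onto one of its subsets with `q` elements. They parametrize,
with repetitions, the partitions of `ι` into `q` classes. -/
def retractions : Finset (ι → ι) :=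
  (Finset.powersetCard q Finset.univ).biUnion fun J =>
    Fintype.piFinset fun i => if i ∈ J then {i} else J

theorem mem_retractions {f : ι → ι} :
    f ∈ retractions ι q ↔
      ∃ J : Finset ι, J.card = q ∧ (∀ i ∈ J, f i = i) ∧ ∀ i, f i ∈ J := by
  simp only [retractions, Finset.mem_biUnion, Finset.mem_powersetCard_univ, Fintype.mem_piFinset]
  refine exists_congr fun J => and_congr_right fun _ => ⟨fun h => ⟨fun i hi => ?_, fun i => ?_⟩,
    fun h i => ?_⟩
  · simpa [hi] using h i
  · by_cases hi : i ∈ J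
    · have hfi : f i = i := by simpa [hi] using h i
      rwa [hfi]
    · simpa [hi] using h i
  · by_cases hi : i ∈ J
    · simpa [hi] using h.1 i hi
    · simpa [hi] using h.2 i

theorem card_retractions_le :
    (retractions ι q).card ≤ (Fintype.card ι).choose q * q ^ (Fintype.card ι - q) := by
  refine (Finset.card_biUnion_le_card_mul _ _ (q ^ (Fintype.card ι - q)) fun J hJ => ?_).trans_eq
    (by rw [Finset.card_powersetCard, Finset.card_univ])
  rw [Finset.mem_powersetCard_univ] at hJ
  rw [Fintype.card_piFinset]
  simp only [apply_ite Finset.card, Finset.card_singleton, hJ, Finset.prod_ite,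
    Finset.prod_const_one, Finset.prod_const, one_mul]
  rw [Finset.filter_not, Finset.filter_univ_mem, ← Finset.compl_eq_univ_sdiff, Finset.card_compl,
    hJ]

theorem exists_mem_retractions_comp_eq {α : Type*} {g : ι → α}
    (hg : (Set.range g).ncard ≤ q) (hq : q ≤ Fintype.card ι) :
    ∃ f ∈ retractions ι q, g ∘ f = g := by
  obtain ⟨S, -, hS⟩ := Set.exists_subset_bijOn Set.univ g
  lift S to Finset ι using S.toFinite
  rw [Set.image_univ] at hS
  have hcard : S.card ≤ q := by
    rwa [← Set.ncard_coe_finset, ← hS.injOn.ncard_image, hS.image_eq]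
  obtain ⟨J, hSJ, hJ⟩ := Finset.exists_superset_card_eq hcard hq
  have hrep : ∀ i, ∃ j ∈ J, g j = g i := fun i => by
    obtain ⟨j, hj, hji⟩ := hS.surjOn ⟨i, rfl⟩
    exact ⟨j, hSJ hj, hji⟩
  choose c hcJ hc using hrep
  refine ⟨fun i => if i ∈ J then i else c i, mem_retractions.2 ⟨J, hJ, ?_, fun i => ?_⟩, ?_⟩
  · exact fun i hi => if_pos hi
  · split_ifs with hi
    exacts [hi, hcJ i]
  · ext i
    dsimp only [Function.comp_apply]
    split_ifs
    exacts [rfl, hc i]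

theorem choose_mul_pow_le {p q : ℕ} (hq : q ≠ 1) (hqp : q ≤ p) :
    p.choose q * q ^ (p - q) ≤ q ^ (3 * (p - q)) := by
  rcases Nat.eq_zero_or_pos q with rfl | hq0
  · rcases Nat.eq_zero_or_pos p with rfl | hp
    · simp
    · simp [hp.ne']
  have hchoose : p.choose q ≤ q ^ (2 * (p - q)) := by
    rcases le_total p (q ^ 2) with hp | hp
    · calc p.choose q = p.choose (p - q) := (Nat.choose_symm hqp).symm
        _ ≤ p ^ (p - q) := Nat.choose_le_pow _ _
        _ ≤ (q ^ 2) ^ (p - q) := Nat.pow_le_pow_left hp _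
        _ = q ^ (2 * (p - q)) := (pow_mul _ _ _).symm
    · have h2q : 2 * q ≤ p := by nlinarith [show 2 ≤ q by omega]
      calc p.choose q ≤ 2 ^ p := Nat.choose_le_two_pow _ _
        _ ≤ q ^ p := Nat.pow_le_pow_left (by omega) _
        _ ≤ q ^ (2 * (p - q)) := Nat.pow_le_pow_right hq0 (by omega)
  calc p.choose q * q ^ (p - q) ≤ q ^ (2 * (p - q)) * q ^ (p - q) := by gcongr
    _ = q ^ (3 * (p - q)) := by rw [← pow_add]; congr 1; ring

/-- The real functions on the domain of `f` that factor through `f`; they are constant on the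
fibres of `f`. -/
def fibreConstant {ι κ : Type*} (f : ι → κ) : Submodule ℝ (ι → ℝ) :=
  LinearMap.range (LinearMap.funLeft ℝ ℝ f)

theorem finrank_fibreConstant_le {ι κ : Type*} {f : ι → κ} {J : Finset κ} (hf : ∀ i, f i ∈ J) :
    finrank ℝ (fibreConstant f) ≤ J.card := by
  have hle : fibreConstant f ≤ fibreConstant fun i => (⟨f i, hf i⟩ : J) := by
    rintro _ ⟨v, rfl⟩
    exact ⟨fun j => v j, rfl⟩
  have : FiniteDimensional ℝ (fibreConstant fun i => (⟨f i, hf i⟩ : J)) :=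
    LinearMap.finiteDimensional_range _
  calc finrank ℝ (fibreConstant f) ≤ finrank ℝ (fibreConstant fun i => (⟨f i, hf i⟩ : J)) :=
        Submodule.finrank_mono hle
    _ ≤ finrank ℝ (J → ℝ) := LinearMap.finrank_range_le _
    _ = J.card := by rw [finrank_fintype_fun_eq_card, Fintype.card_coe]

theorem exists_finset_submodule_col_mem (q p m : ℕ) (hqp : q ≤ p) :
    ∃ 𝒰 : Finset (Submodule ℝ (Fin p → ℝ)), 𝒰.card ≤ q ^ (3 * (p - q)) ∧
      (∀ U ∈ 𝒰, finrank ℝ U ≤ q) ∧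
      ∀ B : Matrix (Fin p) (Fin m) ℝ, numDistinctRows B ≤ q → ∃ U ∈ 𝒰, ∀ j, B.col j ∈ U := by
  classical
  -- For `q = 1` there are `p` retractions, but they all define the space of constant vectors.
  rcases eq_or_ne q 1 with rfl | hq
  · refine ⟨{fibreConstant fun _ => ()}, by simp, ?_, fun B hB =>
      ⟨_, Finset.mem_singleton_self _, fun j => ?_⟩⟩
    · simp only [Finset.mem_singleton, forall_eq]
      exact finrank_fibreConstant_le (J := {()}) (by simp)
    · have hrow : ∀ i i', B i = B i' := fun i i' =>
        (Set.ncard_le_one (Set.finite_range _)).1 hB _ ⟨i, rfl⟩ _ ⟨i', rfl⟩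
      exact ⟨fun _ => B ⟨0, hqp⟩ j, funext fun i => congrFun (hrow _ i) j⟩
  · refine ⟨(retractions (Fin p) q).image fibreConstant, ?_, ?_, fun B hB => ?_⟩
    · calc _ ≤ (retractions (Fin p) q).card := Finset.card_image_le
        _ ≤ p.choose q * q ^ (p - q) := by simpa using card_retractions_le (ι := Fin p) (q := q)
        _ ≤ q ^ (3 * (p - q)) := choose_mul_pow_le hq hqp
    · rw [Finset.forall_mem_image]
      intro f hf
      obtain ⟨J, rfl, -, hJ⟩ := mem_retractions.1 hf
      exact finrank_fibreConstant_le hJ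
    · obtain ⟨f, hf, hBf⟩ := exists_mem_retractions_comp_eq hB (by simpa using hqp)
      exact ⟨_, Finset.mem_image_of_mem _ hf, fun j =>
        ⟨B.col j, funext fun i => congrFun (congrFun hBf i) j⟩⟩

end Selections

section LowRank

variable {V W ι : Type*} [NormedAddCommGroup V] [InnerProductSpace ℝ V] [NormedAddCommGroup W]
  [InnerProductSpace ℝ W] [Fintype ι] {k : ℕ}

/-- Componentwise application of a linear map to a vector with components in `W`, as a bilinear
map. For `V = ℝⁿ` and `W = ℝᵏ` this is the product of an `n × k` and a `k × ι` matrix. -/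
def mapComponents :
    (W →L[ℝ] V) →ₗ[ℝ] PiLp 2 (fun _ : ι => W) →ₗ[ℝ] PiLp 2 (fun _ : ι => V) :=
  LinearMap.mk₂ ℝ (fun A y => WithLp.toLp 2 fun j => A (y j))
    (fun _ _ _ => rfl) (fun _ _ _ => rfl)
    (fun A y y' => by ext j; exact map_add A (y j) (y' j))
    (fun c A y => by ext j; exact map_smul A c (y j))

theorem norm_mapComponents_le (A : W →L[ℝ] V) (y : PiLp 2 fun _ : ι => W) :
    ‖mapComponents A y‖ ≤ ‖A‖ * ‖y‖ := by
  refine le_of_sq_le_sq ?_ (by positivity)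
  rw [mul_pow, PiLp.norm_sq_eq_of_L2, PiLp.norm_sq_eq_of_L2, Finset.mul_sum]
  gcongr with j
  rw [← mul_pow]
  exact pow_le_pow_left₀ (norm_nonneg _) (A.le_opNorm (y j)) 2

theorem exists_linearIsometry_euclideanSpace [FiniteDimensional ℝ W] (h : finrank ℝ W ≤ k) :
    Nonempty (W →ₗᵢ[ℝ] EuclideanSpace ℝ (Fin k)) := by
  let b := stdOrthonormalBasis ℝ W
  let b' : Fin (finrank ℝ W) → EuclideanSpace ℝ (Fin k) :=
    EuclideanSpace.basisFun (Fin k) ℝ ∘ Fin.castLE h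
  have hb' : Orthonormal ℝ b' :=
    (EuclideanSpace.basisFun (Fin k) ℝ).orthonormal.comp _ (Fin.castLE_injective h)
  exact ⟨(b.toBasis.constr ℝ b').isometryOfOrthonormal (v := b.toBasis) (by simp)
    (by convert hb' using 1; ext1 i; simp)⟩

theorem exists_mapComponents_eq [FiniteDimensional ℝ V] {z : PiLp 2 fun _ : ι => V}
    (hz : finrank ℝ (Submodule.span ℝ (Set.range z)) ≤ k) :
    ∃ (A : EuclideanSpace ℝ (Fin k) →L[ℝ] V) (y : PiLp 2 fun _ : ι => EuclideanSpace ℝ (Fin k)),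
      mapComponents A y = z ∧ ‖A‖ * ‖y‖ ≤ ‖z‖ := by
  set W := Submodule.span ℝ (Set.range z)
  obtain ⟨L⟩ := exists_linearIsometry_euclideanSpace hz
  let z' : ι → W := fun j => ⟨z j, Submodule.subset_span ⟨j, rfl⟩⟩
  let A := W.subtypeL ∘L L.toContinuousLinearMap.adjoint
  let y := WithLp.toLp 2 fun j => L (z' j)
  have hA : ‖A‖ ≤ 1 := by
    refine (ContinuousLinearMap.opNorm_comp_le _ _).trans
      (mul_le_one₀ W.norm_subtypeL_le (norm_nonneg _) ?_)
    rw [LinearIsometryEquiv.norm_map]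
    exact L.norm_toContinuousLinearMap_le
  have hy : ‖y‖ = ‖z‖ := by
    simp only [y, PiLp.norm_eq_of_L2, L.norm_map]
    rfl
  have hadj : ∀ w, L.toContinuousLinearMap.adjoint (L w) = w :=
    DFunLike.congr_fun
      (ContinuousLinearMap.norm_map_iff_adjoint_comp_self L.toContinuousLinearMap |>.1 L.norm_map)
  refine ⟨A, y, ?_, ?_⟩
  · ext j
    exact congrArg W.subtype (hadj (z' j))
  · rw [hy]
    exact mul_le_of_le_one_left (norm_nonneg z) hA

theorem exists_isNorming_finrank_span_le (V ι : Type*) [NormedAddCommGroup V]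
    [InnerProductSpace ℝ V] [FiniteDimensional ℝ V] [Fintype ι] (k : ℕ) :
    ∃ s : Finset (PiLp 2 fun _ : ι => V), s.card ≤ 5 ^ (k * (finrank ℝ V + Fintype.card ι)) ∧
      IsNorming s 4 {z | finrank ℝ (Submodule.span ℝ (Set.range z)) ≤ k} := by
  classical
  obtain ⟨s, hscard, hs⟩ := exists_isNorming_univ (EuclideanSpace ℝ (Fin k) →L[ℝ] V)
  obtain ⟨t, htcard, ht⟩ := exists_isNorming_univ (PiLp 2 fun _ : ι => EuclideanSpace ℝ (Fin k))
  rw [show (4 : ℝ≥0) = 2 * 2 by norm_num]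
  refine ⟨_, (Finset.card_image₂_le _ _ _).trans ?_,
    (hs.image₂ ht mapComponents norm_mapComponents_le).mono fun _ hz => exists_mapComponents_eq hz⟩
  have hs' : finrank ℝ (EuclideanSpace ℝ (Fin k) →L[ℝ] V) = k * finrank ℝ V := by
    rw [← (LinearMap.toContinuousLinearMap (𝕜 := ℝ)).finrank_eq, finrank_linearMap,
      finrank_euclideanSpace_fin]
  have ht' : finrank ℝ (PiLp 2 fun _ : ι => EuclideanSpace ℝ (Fin k)) = k * Fintype.card ι := by
    rw [(WithLp.linearEquiv 2 ℝ (ι → EuclideanSpace ℝ (Fin k))).finrank_eq, finrank_pi_fintype]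
    simp [mul_comm]
  rw [mul_add, pow_add, ← hs', ← ht']
  exact Nat.mul_le_mul hscard htcard

end LowRank

section LowRankMatrix

variable {ι κ : Type*} [Fintype ι] [Fintype κ]

/-- The matrix with given columns in a subspace of Euclidean space. -/
def ofColumns (V : Submodule ℝ (EuclideanSpace ℝ ι)) :
    PiLp 2 (fun _ : κ => V) →ₗᵢ[ℝ] Matrix ι κ ℝ where
  toFun z := Matrix.of fun i j => (z j : EuclideanSpace ℝ ι) i
  map_add' _ _ := rfl
  map_smul' _ _ := rfl
  norm_map' z := by
    rw [← sq_eq_sq₀ (norm_nonneg _) (norm_nonneg _), PiLp.norm_sq_eq_of_L2,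
      Matrix.frobenius_norm_def, ← Real.sqrt_eq_rpow, Real.sq_sqrt (by positivity),
      Finset.sum_comm]
    simp only [Submodule.coe_norm, EuclideanSpace.norm_sq_eq, Real.rpow_two]
    rfl

theorem exists_isNorming_rank_le (V : Submodule ℝ (ι → ℝ)) (κ : Type*) [Fintype κ] (k : ℕ) :
    ∃ s : Finset (Matrix ι κ ℝ), s.card ≤ 5 ^ (k * (finrank ℝ V + Fintype.card κ)) ∧
      IsNorming s 4 {Z | Z.rank ≤ k ∧ ∀ j, Z.col j ∈ V} := by
  classical
  let e := (WithLp.linearEquiv 2 ℝ (ι → ℝ)).symm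
  let V' : Submodule ℝ (EuclideanSpace ℝ ι) := V.map e.toLinearMap
  obtain ⟨s, hcard, hs⟩ := exists_isNorming_finrank_span_le V' κ k
  have hV' : finrank ℝ V' = finrank ℝ V := e.finrank_map_eq V
  rw [hV'] at hcard
  refine ⟨s.image (ofColumns V'), Finset.card_image_le.trans hcard,
    (hs.image (ofColumns V')).mono ?_⟩
  rintro Z ⟨hrank, hZ⟩
  let z : PiLp 2 (fun _ : κ => V') :=
    WithLp.toLp 2 fun j => ⟨e (Z.col j), Submodule.mem_map_of_mem (hZ j)⟩
  have hspan : (Submodule.span ℝ (Set.range z)).map (e.symm.toLinearMap ∘ₗ V'.subtype) =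
      Submodule.span ℝ (Set.range Z.col) := by
    rw [Submodule.map_span, ← Set.range_comp]
    rfl
  have hinj : Function.Injective (e.symm.toLinearMap ∘ₗ V'.subtype) :=
    e.symm.injective.comp V'.subtype_injective
  refine ⟨z, ?_, rfl⟩
  rwa [Set.mem_ofPred_eq, (Submodule.equivMapOfInjective _ hinj _).finrank_eq, hspan,
    ← Z.rank_eq_finrank_span_cols]

end LowRankMatrix

theorem matrix_rank_sub_le {K ι κ : Type*} [Field K] [Finite ι] [Fintype κ] (A B : Matrix ι κ K) :
    (A - B).rank ≤ A.rank + B.rank := by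
  have hle : LinearMap.range (A - B).mulVecLin ≤
      LinearMap.range A.mulVecLin ⊔ LinearMap.range B.mulVecLin := by
    rintro _ ⟨v, rfl⟩
    rw [Matrix.mulVecLin_apply, Matrix.sub_mulVec]
    exact Submodule.sub_mem _ (Submodule.mem_sup_left ⟨v, rfl⟩) (Submodule.mem_sup_right ⟨v, rfl⟩)
  exact (Submodule.finrank_mono hle).trans (Submodule.finrank_add_le_finrank_add_finrank _ _)

section Predictions

variable {n p m q r : ℕ}

theorem finrank_map_mulVecLin_le (X : Matrix (Fin n) (Fin p) ℝ) (U : Submodule ℝ (Fin p → ℝ)) :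
    finrank ℝ (U.map X.mulVecLin) ≤ min (finrank ℝ U) X.rank :=
  le_min (Submodule.finrank_map_le _ _) (Submodule.finrank_mono LinearMap.map_le_range)

theorem exists_isNorming_predictions (X : Matrix (Fin n) (Fin p) ℝ)
    {B₀ : Matrix (Fin p) (Fin m) ℝ} (hB₀ : B₀ ∈ crlClass p m q r) (hqp : q ≤ p) :
    ∃ s : Finset (Matrix (Fin n) (Fin m) ℝ),
      s.card ≤ q ^ (3 * (p - q)) * 5 ^ (2 * r * (2 * min q X.rank + m)) ∧
        IsNorming s 4 ((fun B => X * B - X * B₀) '' crlClass p m q r) := by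
  classical
  obtain ⟨𝒰, hcard, hdim, hcov⟩ := exists_finset_submodule_col_mem q p m hqp
  obtain ⟨U₀, hU₀, hB₀U₀⟩ := hcov B₀ hB₀.2
  choose s hscard hs using fun U : Submodule ℝ (Fin p → ℝ) =>
    exists_isNorming_rank_le ((U ⊔ U₀).map X.mulVecLin) (Fin m) (2 * r)
  have hfinrank : ∀ U ∈ 𝒰, finrank ℝ ((U ⊔ U₀).map X.mulVecLin) ≤ 2 * min q X.rank := by
    intro U hU
    have hmap := finrank_map_mulVecLin_le X (U ⊔ U₀)
    have hsup := Submodule.finrank_add_le_finrank_add_finrank U U₀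
    have hUq := hdim U hU
    have hU₀q := hdim U₀ hU₀
    omega
  refine ⟨𝒰.biUnion s, ?_, (IsNorming.biUnion fun U _ => hs U).mono ?_⟩
  · refine (Finset.card_biUnion_le_card_mul _ _ _ fun U hU => (hscard U).trans ?_).trans
      (Nat.mul_le_mul_right _ hcard)
    rw [Fintype.card_fin]
    gcongr
    exacts [by norm_num, hfinrank U hU]
  · rintro _ ⟨B, hB, rfl⟩
    obtain ⟨U, hU, hBU⟩ := hcov B hB.2
    refine Set.mem_iUnion₂.2 ⟨U, hU, ?_, fun j => ⟨B.col j - B₀.col j, ?_, ?_⟩⟩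
    · dsimp only
      rw [← Matrix.mul_sub, two_mul]
      exact (Matrix.rank_mul_le_right _ _).trans
        ((matrix_rank_sub_le _ _).trans (add_le_add hB.1 hB₀.1))
    · exact Submodule.sub_mem _ (Submodule.mem_sup_left (hBU j))
        (Submodule.mem_sup_right (hB₀U₀ j))
    · exact map_sub X.mulVecLin (B.col j) (B₀.col j)

theorem sub_mul_log_nonneg (hqp : q ≤ p) : 0 ≤ ((p : ℝ) - q) * Real.log q :=
  mul_nonneg (sub_nonneg.2 (by exact_mod_cast hqp)) (Real.log_natCast_nonneg q)

theorem Po_nonneg (m : ℕ) (X : Matrix (Fin n) (Fin p) ℝ) (r : ℕ) (hqp : q ≤ p) :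
    0 ≤ Po m X q r := by
  rw [Po]
  exact add_nonneg (by positivity) (sub_mul_log_nonneg hqp)

theorem pow_mul_pow_le_exp_Po (m : ℕ) (X : Matrix (Fin n) (Fin p) ℝ) (r : ℕ) (hqp : q ≤ p) :
    ((q ^ (3 * (p - q)) * 5 ^ (2 * r * (2 * min q X.rank + m)) : ℕ) : ℝ) ≤
      Real.exp (16 * Po m X q r) := by
  have hpow : ∀ {a b : ℝ} (k : ℕ), 0 ≤ a → a ≤ Real.exp b → a ^ k ≤ Real.exp (k * b) := by
    intro a b k ha hab
    rw [Real.exp_nat_mul]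
    gcongr
  have hfive : (5 : ℝ) ≤ Real.exp 4 := by linarith [Real.add_one_le_exp 4]
  push_cast [-Nat.cast_min]
  calc (q : ℝ) ^ (3 * (p - q)) * 5 ^ (2 * r * (2 * min q X.rank + m))
      ≤ Real.exp ((3 * (p - q) : ℕ) * Real.log q) *
          Real.exp ((2 * r * (2 * min q X.rank + m) : ℕ) * 4) :=
        mul_le_mul (hpow _ q.cast_nonneg (Real.le_exp_log _)) (hpow _ (by norm_num) hfive)
          (by positivity) (by positivity)
    _ ≤ Real.exp (16 * Po m X q r) := by
        rw [← Real.exp_add, Real.exp_le_exp, Po]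
        push_cast [-Nat.cast_min, hqp]
        nlinarith [show (0 : ℝ) ≤ m * r by positivity, sub_mul_log_nonneg hqp]

end Predictions

section SubGaussian

variable {Ω : Type*} [MeasurableSpace Ω] {μ : Measure Ω} {σ : ℝ}

theorem lintegral_exp_sq_le_of_psi2Norm_lt {ξ : Ω → ℝ} {t : ℝ}
    (h : psi2Norm μ ξ < ENNReal.ofReal t) :
    ∫⁻ ω, ENNReal.ofReal (Real.exp ((ξ ω / t) ^ 2)) ∂μ ≤ 2 := by
  simp only [psi2Norm, iInf_lt_iff] at h
  obtain ⟨u, hu, hint, hut⟩ := h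
  have hut' : u ≤ t := ((ENNReal.ofReal_lt_ofReal_iff_of_nonneg hu.le).1 hut).le
  refine (lintegral_mono fun ω => ENNReal.ofReal_le_ofReal (Real.exp_le_exp.2 ?_)).trans hint
  rw [div_pow, div_pow]
  gcongr

theorem integrable_and_integral_exp_sq_le_of_psi2Norm_lt {ξ : Ω → ℝ} {t : ℝ} (hξ : AEMeasurable ξ μ)
    (h : psi2Norm μ ξ < ENNReal.ofReal t) :
    Integrable (fun ω => Real.exp ((ξ ω / t) ^ 2)) μ ∧
      ∫ ω, Real.exp ((ξ ω / t) ^ 2) ∂μ ≤ 2 := by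
  have hmeas : AEStronglyMeasurable (fun ω => Real.exp ((ξ ω / t) ^ 2)) μ :=
    (Real.measurable_exp.comp_aemeasurable ((hξ.div_const t).pow_const 2)).aestronglyMeasurable
  have hpos : 0 ≤ᵐ[μ] fun ω => Real.exp ((ξ ω / t) ^ 2) := .of_forall fun _ => (Real.exp_pos _).le
  have hle := lintegral_exp_sq_le_of_psi2Norm_lt h
  refine ⟨⟨hmeas, (hasFiniteIntegral_iff_ofReal hpos).2 (hle.trans_lt (by simp))⟩, ?_⟩
  rw [integral_eq_lintegral_of_nonneg_ae hpos hmeas]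
  exact ENNReal.toReal_le_of_le_ofReal (by norm_num) (by simpa using hle)

theorem iSup_sq_le {ι : Type*} [Fintype ι] (x : ι → ℝ) {a t : ℝ} (ha : 0 ≤ a) (ht : 0 < t) :
    ⨆ i, x i ^ 2 ≤ t ^ 2 * (a + Real.exp (-a) * ∑ i, Real.exp ((x i / t) ^ 2)) := by
  have hexp : ∀ i, 0 ≤ Real.exp ((x i / t) ^ 2) := fun i => (Real.exp_pos _).le
  refine Real.iSup_le (fun i => ?_) (by positivity)
  calc x i ^ 2 = t ^ 2 * (x i / t) ^ 2 := by field_simp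
    _ ≤ t ^ 2 * (a + Real.exp ((x i / t) ^ 2 - a)) := by
        gcongr
        linarith [Real.add_one_le_exp ((x i / t) ^ 2 - a)]
    _ = t ^ 2 * (a + Real.exp (-a) * Real.exp ((x i / t) ^ 2)) := by
        rw [← Real.exp_add, neg_add_eq_sub]
    _ ≤ t ^ 2 * (a + Real.exp (-a) * ∑ i, Real.exp ((x i / t) ^ 2)) := by
        gcongr
        exact Finset.single_le_sum (f := fun i => Real.exp ((x i / t) ^ 2))
          (fun i _ => hexp i) (Finset.mem_univ i)

theorem integrable_and_integral_iSup_sq_le_of_psi2Norm_lt [IsProbabilityMeasure μ] {ι : Type*}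
    [Fintype ι] {ξ : ι → Ω → ℝ} {a t : ℝ} (hξ : ∀ i, AEMeasurable (ξ i) μ) (ht : 0 < t)
    (hψ : ∀ i, psi2Norm μ (ξ i) < ENNReal.ofReal t) (ha : 0 ≤ a)
    (hcard : (Fintype.card ι : ℝ) ≤ Real.exp a) :
    Integrable (fun ω => ⨆ i, ξ i ω ^ 2) μ ∧ ∫ ω, ⨆ i, ξ i ω ^ 2 ∂μ ≤ t ^ 2 * (a + 2) := by
  have hmeas : AEMeasurable (fun ω => ⨆ i, ξ i ω ^ 2) μ := .iSup fun i => (hξ i).pow_const 2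
  have hexp := fun i => integrable_and_integral_exp_sq_le_of_psi2Norm_lt (hξ i) (hψ i)
  have hsum := integrable_finsetSum Finset.univ fun i _ => (hexp i).1
  have hdom := ((integrable_const a).add (hsum.const_mul (Real.exp (-a)))).const_mul (t ^ 2)
  have hle := fun ω => iSup_sq_le (fun i => ξ i ω) ha ht
  have hint : Integrable (fun ω => ⨆ i, ξ i ω ^ 2) μ :=
    hdom.mono' hmeas.aestronglyMeasurable <| .of_forall fun ω => by
      rw [Real.norm_of_nonneg (Real.iSup_nonneg fun i => sq_nonneg _)]
      exact hle ω
  refine ⟨hint, (integral_mono hint hdom hle).trans ?_⟩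
  simp only [Pi.add_apply]
  rw [integral_const_mul, integral_add (integrable_const a) (hsum.const_mul _),
    integral_const_mul, integral_finsetSum _ fun i _ => (hexp i).1, integral_const,
    probReal_univ, one_smul]
  gcongr
  calc Real.exp (-a) * ∑ i, ∫ ω, Real.exp ((ξ i ω / t) ^ 2) ∂μ
      ≤ Real.exp (-a) * ∑ _i : ι, 2 := by gcongr with i; exact (hexp i).2
    _ = Real.exp (-a) * Fintype.card ι * 2 := by simp [mul_assoc]
    _ ≤ Real.exp (-a) * Real.exp a * 2 := by gcongr
    _ = 2 := by rw [← Real.exp_add]; simp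

theorem integrable_and_integral_iSup_sq_le [IsProbabilityMeasure μ] {ι : Type*} [Fintype ι]
    {ξ : ι → Ω → ℝ} {a : ℝ} (hξ : ∀ i, AEMeasurable (ξ i) μ) (hσ : 0 ≤ σ)
    (hψ : ∀ i, psi2Norm μ (ξ i) ≤ ENNReal.ofReal σ) (ha : 0 ≤ a)
    (hcard : (Fintype.card ι : ℝ) ≤ Real.exp a) :
    Integrable (fun ω => ⨆ i, ξ i ω ^ 2) μ ∧ ∫ ω, ⨆ i, ξ i ω ^ 2 ∂μ ≤ σ ^ 2 * (a + 2) := by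
  have hbound : ∀ t, σ < t → Integrable (fun ω => ⨆ i, ξ i ω ^ 2) μ ∧
      ∫ ω, ⨆ i, ξ i ω ^ 2 ∂μ ≤ t ^ 2 * (a + 2) := by
    intro t hσt
    have ht : 0 < t := hσ.trans_lt hσt
    exact integrable_and_integral_iSup_sq_le_of_psi2Norm_lt hξ ht
      (fun i => (hψ i).trans_lt ((ENNReal.ofReal_lt_ofReal_iff ht).2 hσt)) ha hcard
  refine ⟨(hbound (σ + 1) (lt_add_one σ)).1, ?_⟩
  refine ge_of_tendsto (x := nhdsWithin σ (Set.Ioi σ)) (f := fun t => t ^ 2 * (a + 2))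
    (Continuous.continuousWithinAt (by fun_prop)) ?_
  filter_upwards [self_mem_nhdsWithin] with t ht using (hbound t ht).2

end SubGaussian

section RiskBound

variable {Ω : Type*} [MeasurableSpace Ω] {μ : Measure Ω} {n p m q r : ℕ}

theorem aemeasurable_frobInner {E : Ω → Matrix (Fin n) (Fin m) ℝ}
    (hE : ∀ i j, AEMeasurable (fun ω => E ω i j) μ) (A : Matrix (Fin n) (Fin m) ℝ) :
    AEMeasurable (fun ω => frobInner (E ω) A) μ :=
  Finset.aemeasurable_fun_sum _ fun i _ => Finset.aemeasurable_fun_sum _ fun j _ =>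
    (hE i j).mul_const _

theorem aemeasurable_frobenius_norm {Z : Ω → Matrix (Fin n) (Fin m) ℝ}
    (hZ : ∀ i j, AEMeasurable (fun ω => Z ω i j) μ) : AEMeasurable (fun ω => ‖Z ω‖) μ := by
  simp only [Matrix.frobenius_norm_def]
  exact (Finset.aemeasurable_fun_sum _ fun i _ => Finset.aemeasurable_fun_sum _ fun j _ =>
    (hZ i j).norm.pow_const _).pow_const _

theorem sq_le_of_mul_sq_le {s g c δ κ : ℝ} (hδ : 0 < δ) (hg : 0 ≤ g)
    (h : δ / 2 * s ^ 2 ≤ κ * √g * s + c) : s ^ 2 ≤ 4 * κ ^ 2 / δ ^ 2 * g + 4 / δ * c := by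
  have hamgm : κ * √g * s ≤ δ / 4 * s ^ 2 + κ ^ 2 / δ * g := by
    have hsq : 0 ≤ (δ * s - 2 * κ * √g) ^ 2 / (4 * δ) := by positivity
    have hexpand : (δ * s - 2 * κ * √g) ^ 2 / (4 * δ) =
        δ / 4 * s ^ 2 + κ ^ 2 / δ * √g ^ 2 - κ * √g * s := by
      field_simp
      ring
    rw [hexpand, Real.sq_sqrt hg] at hsq
    linarith
  calc s ^ 2 = 4 / δ * (δ / 4 * s ^ 2) := by field_simp
    _ ≤ 4 / δ * (κ ^ 2 / δ * g + c) := by gcongr; linarith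
    _ = 4 * κ ^ 2 / δ ^ 2 * g + 4 / δ * c := by field_simp

theorem IsNorming.frobInner_le {s : Finset (Matrix (Fin n) (Fin m) ℝ)} {κ : ℝ≥0}
    {T : Set (Matrix (Fin n) (Fin m) ℝ)} (hs : IsNorming s κ T) (E : Matrix (Fin n) (Fin m) ℝ)
    {Z : Matrix (Fin n) (Fin m) ℝ} (hZ : Z ∈ T) :
    frobInner E Z ≤ κ * √(⨆ A : s, frobInner E A ^ 2) * ‖Z‖ :=
  hs.apply_le (isLinearMap_frobInner E).mk' _ (Real.sqrt_nonneg _)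
    (fun A hA => Real.le_sqrt_of_sq_le <|
      le_ciSup (f := fun A : s => frobInner E A ^ 2) (Set.finite_range _).bddAbove ⟨A, hA⟩) Z hZ

theorem IsNorming.integrable_and_integral_norm_sq_le [IsProbabilityMeasure μ]
    {s : Finset (Matrix (Fin n) (Fin m) ℝ)} {κ : ℝ≥0} {T : Set (Matrix (Fin n) (Fin m) ℝ)}
    {E Z : Ω → Matrix (Fin n) (Fin m) ℝ} {σ δ a c : ℝ} (hs : IsNorming s κ T) (ha : 0 ≤ a)
    (hcard : (s.card : ℝ) ≤ Real.exp a) (hσ : 0 ≤ σ)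
    (hE : ∀ i j, AEMeasurable (fun ω => E ω i j) μ)
    (hψ : ∀ A, psi2Norm μ (fun ω => frobInner (E ω) A) ≤ ENNReal.ofReal (σ * ‖A‖))
    (hδ : 0 < δ) (hZ : ∀ i j, AEMeasurable (fun ω => Z ω i j) μ)
    (h : ∀ᵐ ω ∂μ, Z ω ∈ T ∧ δ / 2 * ‖Z ω‖ ^ 2 ≤ frobInner (E ω) (Z ω) + c) :
    Integrable (fun ω => ‖Z ω‖ ^ 2) μ ∧
      ∫ ω, ‖Z ω‖ ^ 2 ∂μ ≤ 4 * κ ^ 2 / δ ^ 2 * (σ ^ 2 * (a + 2)) + 4 / δ * c := by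
  obtain ⟨hint, hmean⟩ := integrable_and_integral_iSup_sq_le
    (ξ := fun (A : s) ω => frobInner (E ω) A) (fun A => aemeasurable_frobInner hE A) hσ
    (fun A => (hψ A).trans
      (ENNReal.ofReal_le_ofReal (mul_le_of_le_one_right hσ (hs.norm_le_one A A.2))))
    ha (by rwa [Fintype.card_coe])
  have hdom := (hint.const_mul (4 * (κ : ℝ) ^ 2 / δ ^ 2)).add (integrable_const (4 / δ * c))
  have hle : ∀ᵐ ω ∂μ, ‖Z ω‖ ^ 2 ≤
      4 * κ ^ 2 / δ ^ 2 * (⨆ A : s, frobInner (E ω) A ^ 2) + 4 / δ * c := by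
    filter_upwards [h] with ω ⟨hT, hω⟩
    exact sq_le_of_mul_sq_le hδ (Real.iSup_nonneg fun A => sq_nonneg _)
      (hω.trans (add_le_add_left (hs.frobInner_le (E ω) hT) c))
  have hintZ : Integrable (fun ω => ‖Z ω‖ ^ 2) μ := by
    refine hdom.mono' ((aemeasurable_frobenius_norm hZ).pow_const 2).aestronglyMeasurable ?_
    filter_upwards [hle] with ω hω
    rwa [Real.norm_of_nonneg (sq_nonneg _)]
  refine ⟨hintZ, (integral_mono_ae hintZ hdom hle).trans ?_⟩
  simp only [Pi.add_apply]
  rw [integral_add (hint.const_mul _) (integrable_const _), integral_const_mul, integral_const,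
    probReal_univ, one_smul]
  gcongr

theorem risk_constant_le {σ δ K P : ℝ} (hδ : 0 < δ) (hP : 0 ≤ P) :
    4 * 4 ^ 2 / δ ^ 2 * (σ ^ 2 * (16 * P + 2)) + 4 / δ * (K * σ ^ 2 * P) ≤
      1028 * (max (K * δ) 1 / δ ^ 2) * (σ ^ 2 * (P + 1)) := by
  set M := max (K * δ) 1
  calc _ = 64 * (1 / δ ^ 2) * (σ ^ 2 * (16 * P + 2)) + 4 * (K * δ / δ ^ 2) * (σ ^ 2 * P) := by
        field_simp
        ring
    _ ≤ 64 * (M / δ ^ 2) * (σ ^ 2 * (16 * (P + 1))) + 4 * (M / δ ^ 2) * (σ ^ 2 * (P + 1)) := by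
        gcongr
        · exact le_max_right _ _
        · linarith
        · exact le_max_left _ _
        · linarith
    _ = 1028 * (M / δ ^ 2) * (σ ^ 2 * (P + 1)) := by ring

theorem theorem2_general {X : Matrix (Fin n) (Fin p) ℝ} {Bstar : Matrix (Fin p) (Fin m) ℝ}
    [IsProbabilityMeasure μ] {l : Ω → Matrix (Fin n) (Fin m) ℝ → ℝ}
    {Bhat : Ω → Matrix (Fin p) (Fin m) ℝ} {σ ρ δ K : ℝ} (hrank : Bstar.rank ≤ r)
    (hrows : numDistinctRows Bstar ≤ q) (hqp : q ≤ p) (_hl : ∀ᵐ ω ∂μ, Differentiable ℝ (l ω))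
    (hσ : 0 ≤ σ) (hE : ∀ i j, AEMeasurable (fun ω => (-matGrad (l ω) (X * Bstar)) i j) μ)
    (hψ : ∀ A, psi2Norm μ (fun ω => frobInner (-matGrad (l ω) (X * Bstar)) A) ≤
      ENNReal.ofReal (σ * ‖A‖))
    (hδ : 0 < δ) (hreg : ∀ᵐ ω ∂μ, RestrictedRegularity (l ω) X ρ δ K σ q r)
    (hmeas : ∀ i j, AEMeasurable (fun ω => Bhat ω i j) μ)
    (hfix : ∀ᵐ ω ∂μ, IsCRLFixedPoint (l ω) X ρ q r (Bhat ω)) :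
    Integrable (fun ω => ‖X * Bhat ω - X * Bstar‖ ^ 2) μ ∧
      ∫ ω, ‖X * Bhat ω - X * Bstar‖ ^ 2 ∂μ ≤
        1028 * (max (K * δ) 1 / δ ^ 2) *
          (σ ^ 2 * ((min q X.rank : ℕ) + (m : ℝ)) * r
            + σ ^ 2 * ((p : ℝ) - q) * Real.log q + σ ^ 2) := by
  have hBstar : Bstar ∈ crlClass p m q r := ⟨hrank, hrows⟩
  have hPo := Po_nonneg m X r hqp
  obtain ⟨s, hcard, hs⟩ := exists_isNorming_predictions X hBstar hqp
  have hcard' : (s.card : ℝ) ≤ Real.exp (16 * Po m X q r) :=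
    (Nat.cast_le.2 hcard).trans (pow_mul_pow_le_exp_Po m X r hqp)
  have hmeasZ : ∀ i j, AEMeasurable (fun ω => (X * Bhat ω - X * Bstar) i j) μ := by
    intro i j
    simp only [Matrix.sub_apply, Matrix.mul_apply]
    exact (Finset.aemeasurable_fun_sum _ fun k _ => (hmeas k j).const_mul _).sub_const _
  have hbasic : ∀ᵐ ω ∂μ,
      X * Bhat ω - X * Bstar ∈ (fun B => X * B - X * Bstar) '' crlClass p m q r ∧
        δ / 2 * ‖X * Bhat ω - X * Bstar‖ ^ 2 ≤
          frobInner (-matGrad (l ω) (X * Bstar)) (X * Bhat ω - X * Bstar)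
            + K * σ ^ 2 * Po m X q r := by
    filter_upwards [hreg, hfix] with ω hω hBhat
    exact ⟨Set.mem_image_of_mem _ hBhat.1, hBhat.basic_inequality hω hBstar⟩
  obtain ⟨hint, hle⟩ :=
    hs.integrable_and_integral_norm_sq_le (by positivity) hcard' hσ hE hψ hδ hmeasZ hbasic
  refine ⟨hint, hle.trans ((risk_constant_le hδ hPo).trans_eq ?_)⟩
  rw [Po]
  ring

end RiskBound

theorem theorem2 :
    ∃ C : ℝ, 0 < C ∧
      ∀ (n p m q r : ℕ) (X : Matrix (Fin n) (Fin p) ℝ) (Bstar : Matrix (Fin p) (Fin m) ℝ)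
        (Ω : Type*) [MeasurableSpace Ω] (μ : Measure Ω) [IsProbabilityMeasure μ]
        (l₀ : Matrix (Fin n) (Fin m) ℝ → Matrix (Fin n) (Fin m) ℝ → ℝ)
        (Y : Ω → Matrix (Fin n) (Fin m) ℝ) (Bhat : Ω → Matrix (Fin p) (Fin m) ℝ)
        (σ ρ δ K : ℝ),
        Bstar.rank ≤ r → numDistinctRows Bstar ≤ q → q ≤ p →
        (∀ y, Differentiable ℝ fun η => l₀ η y) →
        0 ≤ σ → IsCenteredSubGaussian μ (effectiveNoise l₀ X Bstar Y) σ →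
        0 < ρ → 0 < δ → 0 ≤ K →
        (∀ᵐ ω ∂μ, RestrictedRegularity (fun η => l₀ η (Y ω)) X ρ δ K σ q r) →
        (∀ i j, AEMeasurable (fun ω => Bhat ω i j) μ) →
        (∀ᵐ ω ∂μ, IsCRLFixedPoint (fun η => l₀ η (Y ω)) X ρ q r (Bhat ω)) →
        Integrable (fun ω => ‖X * Bhat ω - X * Bstar‖ ^ 2) μ ∧
          ∫ ω, ‖X * Bhat ω - X * Bstar‖ ^ 2 ∂μ ≤
            C * (max (K * δ) 1 / δ ^ 2) *
              (σ ^ 2 * ((min q X.rank : ℕ) + (m : ℝ)) * r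
                + σ ^ 2 * ((p : ℝ) - q) * Real.log q + σ ^ 2) := by
  exact ⟨1028, by norm_num, fun n p m q r X Bstar Ω _ μ _ l₀ Y Bhat σ ρ δ K hrank hrows hqp hl hσ hE
    _ hδ _ hreg hmeas hfix => theorem2_general hrank hrows hqp (.of_forall fun ω => hl (Y ω)) hσ
      hE.aemeasurable hE.psi2_le hδ hreg hmeas hfix⟩
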